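/- Let $\mathcal A$ be an abelian category (with hom-sets) that is (Ab.3*), i.e. complete, that has a cogenerator (an object $G$ with $\mathrm{Hom}_{\mathcal A}(-,G)$ faithful) and that is $\mathrm{Ext}^1$-small, i.e. the class $\mathrm{Ext}^1_{\mathcal A}(X,Y)$ of equivalence classes of short exact sequences $0\to Y\to E\to X\to 0$ is a set for all $X,Y\in\mathcal A$. Then $\mathcal A$ is also cocomplete, and it is well-powered. All subcategories are full, and orthogonals $\mathcal X^{\perp_1}=\{Y:\mathrm{Ext}^1_{\mathcal A}(X,Y)=0\ \forall X\in\mathcal X\}$ and ${}^{\perp_1}\mathcal X=\{Y:\mathrm{Ext}^1_{\mathcal A}(Y,X)=0\ \forall X\in\mathcal X\}$ are taken in $\mathcal A$ unless said otherwise. $\mathrm{Sub}(\mathcal X)$ and $\mathrm{Quot}(\mathcal X)$ denote the classes of the subobjects, respectively of the epimorphic images, of objects of $\mathcal X$. A torsion pair is a pair $(\mathcal T,\mathcal F)$ of classes with $\mathcal F=\{Y:\mathrm{Hom}(T,Y)=0\ \forall T\in\mathcal T\}$, $\mathcal T=\{X:\mathrm{Hom}(X,F)=0\ \forall F\in\mathcal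 F\}$, such that each object $X$ has an exact sequence $0\to T_X\to X\to F_X\to 0$ with $T_X\in\mathcal T$ and $F_X\in\mathcal F$; then $\mathcal F$ is called a torsion-free class. Let $\mathcal F$ be a torsion-free class in $\mathcal A$ and let $\mathcal C=\mathrm{Quot}(\mathcal F)$, an abelian exact subcategory of $\mathcal A$. Then the following assertions are equivalent: 1. $\mathcal F$ is closed under coproducts in $\mathcal A$ and $\mathcal F=\mathcal C\cap{}^{\perp_1}Q$ for some $Q\in\mathcal F$. 2. $\mathcal F$ is semi-special precovering in $\mathcal A$: for each $M\in\mathcal A$ there is a morphism $\phi\colon F_M\to M$ with $F_M\in\mathcal F$ and $\mathrm{Ker}(\phi)\in\mathcal F^{\perp_1}$ such that $\mathrm{Hom}_{\mathcal A}(F,F_M)\to\mathrm{Hom}_{\mathcal A}(F,M)$ is surjective for all $F\in\mathcal F$. 3. $\mathcal F$ is closed under coproducts in $\mathcal A$ and $(\mathcal F,\mathcal Y)$, where $\mathcal Y=\mathrm{Ker}\,\mathrm{Ext}^1_{\mathcal C}(\mathcal F,-)=\{C\in\mathcal C:\mathrm{Ext}^1_{\mathcal C}(F,C)=0\ \forall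 F\in\mathcal F\}$, is a left complete cotorsion pair in $\mathcal C$: one has $\mathcal F=\{C\in\mathcal C:\mathrm{Ext}^1_{\mathcal C}(C,Y)=0\ \forall Y\in\mathcal Y\}$, and each $C\in\mathcal C$ has an exact sequence $0\to Y\to F\to C\to 0$ with $F\in\mathcal F$ and $Y\in\mathcal Y$. If these equivalent assertions hold, then the following are also equivalent: (a) $\mathcal F$ is the torsion-free class of a quasi-cotilting torsion pair, i.e. there is an object $Q$ with $\mathcal F=\mathrm{Cogen}(Q)=\mathrm{Copres}(Q)=\mathrm{Quot}(\mathrm{Cogen}(Q))\cap{}^{\perp_1}Q$, where $\mathrm{Prod}(Q)$ is the class of direct summands of products of copies of $Q$, $\mathrm{Cogen}(Q)=\mathrm{Sub}(\mathrm{Prod}(Q))$, and $\mathrm{Copres}(Q)$ is the class of kernels of morphisms between objects of $\mathrm{Prod}(Q)$. (b) The cotorsion pair $(\mathcal F,\mathcal Y)$ in $\mathcal C$ of assertion 3 is complete, i.e. it is left complete and each $C\in\mathcal C$ also has an exact sequence $0\to C\to Y\to F\to 0$ with $Y\in\mathcal Y$ and $F\in\mathcal F$. (c) $\mathcal F^{\perp_1}$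 cogenerates $\mathcal F$, i.e. each object of $\mathcal F$ embeds in an object of $\mathcal F^{\perp_1}$. -/

import Mathlib

open CategoryTheory CategoryTheory.Limits

universe v u

namespace CotiltingPrecover

/-! ### First extension classes

The definitions are made for a category with zero morphisms, so that they apply to an abelian
category and, verbatim, to a full subcategory that turns out to be abelian. -/

section Ext

variable {C : Type u} [Category.{v} C] [HasZeroMorphisms C]

/-- An extension of `X` by `Y`: a short exact sequence `0 ⟶ Y ⟶ E ⟶ X ⟶ 0`. -/
structure Extension (X Y : C) where
  /-- the middle term -/
  E : C
  /-- the inclusion of the left term -/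
  i : Y ⟶ E
  /-- the projection onto the right term -/
  p : E ⟶ X
  zero : i ≫ p = 0
  shortExact : (ShortComplex.mk i p zero).ShortExact

/-- Equivalence of extensions: an isomorphism of the middle terms that is compatible with the
identities of `X` and of `Y`. -/
def extensionSetoid (X Y : C) : Setoid (Extension X Y) where
  r e e' := ∃ φ : e.E ≅ e'.E, e.i ≫ φ.hom = e'.i ∧ φ.hom ≫ e'.p = e.p
  iseqv :=
    { refl := fun e => ⟨Iso.refl _, by simp, by simp⟩
      symm := by
        rintro e e' ⟨φ, h₁, h₂⟩
        exact ⟨φ.symm, by simp [← h₁], by simp [← h₂]⟩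
      trans := by
        rintro e e' e'' ⟨φ, h₁, h₂⟩ ⟨ψ, h₃, h₄⟩
        refine ⟨φ ≪≫ ψ, ?_, ?_⟩
        · rw [Iso.trans_hom, ← Category.assoc, h₁, h₃]
        · rw [Iso.trans_hom, Category.assoc, h₄, h₂] }

/-- `Ext¹(X, Y)`: the (possibly large) collection of equivalence classes of extensions of `X`
by `Y`. -/
def Ext1 (X Y : C) : Type (max u v) := Quotient (extensionSetoid X Y)

variable (C) in
/-- A category is `Ext¹`-small if all its `Ext¹(X, Y)` are sets, that is, as small as its
morphism sets. -/
def IsExt1Small : Prop := ∀ X Y : C, Small.{v} (Ext1 X Y)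

/-- `Ext¹(X, Y) = 0`. The class of the split extension is always an element of the group
`Ext¹(X, Y)`, so that the group vanishes when it has at most one element. -/
def Ext1Vanishes (X Y : C) : Prop := Subsingleton (Ext1 X Y)

/-- `P^{⊥₁}`: the objects `Y` with `Ext¹(X, Y) = 0` for all `X` in `P`. -/
def rightPerp1 (P : ObjectProperty C) : ObjectProperty C :=
  fun Y => ∀ X, P X → Ext1Vanishes X Y

/-- `^{⊥₁}P`: the objects `X` with `Ext¹(X, Y) = 0` for all `Y` in `P`. -/
def leftPerp1 (P : ObjectProperty C) : ObjectProperty C :=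
  fun X => ∀ Y, P Y → Ext1Vanishes X Y

/-- `^{⊥₁}Q` for one object `Q`. -/
def leftPerp1Obj (Q : C) : ObjectProperty C := fun X => Ext1Vanishes X Q

/-- `(P, R)` is a cotorsion pair: `R = P^{⊥₁}` and `P = ^{⊥₁}R`. -/
def IsCotorsionPair (P R : ObjectProperty C) : Prop := R = rightPerp1 P ∧ P = leftPerp1 R

/-- A left complete cotorsion pair: a cotorsion pair such that each object `X` has a short exact
sequence `0 ⟶ Y ⟶ P₀ ⟶ X ⟶ 0` with `P₀` in `P` and `Y` in `R`. -/
def IsLeftCompleteCotorsionPair (P R : ObjectProperty C) : Prop :=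
  IsCotorsionPair P R ∧
    ∀ X : C, ∃ (Y P₀ : C) (i : Y ⟶ P₀) (p : P₀ ⟶ X) (w : i ≫ p = 0),
      (ShortComplex.mk i p w).ShortExact ∧ P P₀ ∧ R Y

/-- A right complete cotorsion pair: a cotorsion pair such that each object `X` has a short exact
sequence `0 ⟶ X ⟶ Y ⟶ P₀ ⟶ 0` with `P₀` in `P` and `Y` in `R`. -/
def IsRightCompleteCotorsionPair (P R : ObjectProperty C) : Prop :=
  IsCotorsionPair P R ∧
    ∀ X : C, ∃ (Y P₀ : C) (i : X ⟶ Y) (p : Y ⟶ P₀) (w : i ≫ p = 0),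
      (ShortComplex.mk i p w).ShortExact ∧ P P₀ ∧ R Y

/-- A complete cotorsion pair. -/
def IsCompleteCotorsionPair (P R : ObjectProperty C) : Prop :=
  IsLeftCompleteCotorsionPair P R ∧ IsRightCompleteCotorsionPair P R

end Ext

section Abelian

variable {A : Type u} [Category.{v} A] [Abelian A]

/-- `Quot(P)`: the epimorphic images of objects of `P`. -/
def quot (P : ObjectProperty A) : ObjectProperty A :=
  fun X => ∃ (Y : A) (f : Y ⟶ X), P Y ∧ Epi f

/-- `Sub(P)`: the objects that embed in an object of `P`. -/
def sub (P : ObjectProperty A) : ObjectProperty A :=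
  fun X => ∃ (Y : A) (f : X ⟶ Y), P Y ∧ Mono f

/-- `P` cogenerates `F`: each object of `F` embeds in an object of `P`. -/
def Cogenerates (P F : ObjectProperty A) : Prop := F ≤ sub P

/-- `P` is closed under (set-indexed) coproducts taken in `A`. -/
def IsClosedUnderCoproducts (P : ObjectProperty A) : Prop :=
  ∀ I : Type v, P.IsClosedUnderColimitsOfShape (Discrete I)

/-- `(T, F)` is a torsion pair: `F = T^⊥`, `T = ^⊥F`, and each object `X` has a short exact
sequence `0 ⟶ T₀ ⟶ X ⟶ F₀ ⟶ 0` with `T₀` in `T` and `F₀` in `F`. -/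
def IsTorsionPair (T F : ObjectProperty A) : Prop :=
  T.rightOrthogonal = F ∧ T = F.leftOrthogonal ∧
    ∀ X : A, ∃ (T₀ F₀ : A) (i : T₀ ⟶ X) (p : X ⟶ F₀) (w : i ≫ p = 0),
      (ShortComplex.mk i p w).ShortExact ∧ T T₀ ∧ F F₀

/-- `F` is a torsion-free class. -/
def IsTorsionFreeClass (F : ObjectProperty A) : Prop :=
  ∃ T : ObjectProperty A, IsTorsionPair T F

/-- `f : P₀ ⟶ M` is a semi-special `P`-precover: `P₀` is in `P`, each morphism from an object
of `P` to `M` factors through `f`, and the kernel of `f` is in `P^{⊥₁}`. -/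
def IsSemiSpecialPrecover (P : ObjectProperty A) {P₀ M : A} (f : P₀ ⟶ M) : Prop :=
  P P₀ ∧ (∀ (Y : A) (g : Y ⟶ M), P Y → ∃ h : Y ⟶ P₀, h ≫ f = g) ∧ rightPerp1 P (kernel f)

/-- `P` is semi-special precovering: each object has a semi-special `P`-precover. -/
def IsSemiSpecialPrecovering (P : ObjectProperty A) : Prop :=
  ∀ M : A, ∃ (P₀ : A) (f : P₀ ⟶ M), IsSemiSpecialPrecover P f

/-- `Prod(Q)`: the direct summands of those powers `Q^I`, with `I` a set, that exist in `A`. -/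
def prodClass (Q : A) : ObjectProperty A :=
  fun X => ∃ (I : Type v) (c : Fan (fun _ : I => Q)),
    Nonempty (IsLimit c) ∧ Nonempty (Retract X c.pt)

/-- `Cogen(Q)`: the subobjects of objects of `Prod(Q)`. -/
def cogen (Q : A) : ObjectProperty A := sub (prodClass Q)

/-- `Copres(Q)`: the kernels of morphisms between objects of `Prod(Q)`. -/
def copres (Q : A) : ObjectProperty A :=
  fun X => ∃ (P₀ P₁ : A) (g : P₀ ⟶ P₁) (i : X ⟶ P₀) (w : i ≫ g = 0),
    prodClass Q P₀ ∧ prodClass Q P₁ ∧ Nonempty (IsLimit (KernelFork.ofι i w))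

/-- `Quot(Cogen(Q))`: the objects subcogenerated by `Q`. -/
def subcogen (Q : A) : ObjectProperty A := quot (cogen Q)

/-- `(T, F)` is a quasi-cotilting torsion pair: a torsion pair such that
`F = Cogen(Q) = Copres(Q) = Quot(Cogen(Q)) ∩ ^{⊥₁}Q` for some object `Q`. -/
def IsQuasiCotiltingTorsionPair (T F : ObjectProperty A) : Prop :=
  IsTorsionPair T F ∧
    ∃ Q : A, F = cogen Q ∧ F = copres Q ∧ F = subcogen Q ⊓ leftPerp1Obj Q

/-- The full subcategory `Quot(F)` of `A`, as a category. -/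
abbrev QuotCat (F : ObjectProperty A) := (quot F).FullSubcategory

/-- `F`, as a class of objects of the category `Quot(F)`. -/
def inQuot (F : ObjectProperty A) : ObjectProperty (QuotCat F) := F.inverseImage (quot F).ι

/-- `Ker Ext¹_{Quot(F)}(F, -)`: the objects of `Quot(F)` that are right `Ext¹`-orthogonal to `F`,
where `Ext¹` is taken in the category `Quot(F)`. -/
def kerExt1InQuot (F : ObjectProperty A) : ObjectProperty (QuotCat F) := rightPerp1 (inQuot F)

end Abelian

end CotiltingPrecover

namespace CotiltingPrecover

/-! ### Well-poweredness from a cogenerator -/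

section Cocomplete

variable (A : Type u) [Category.{v} A] [Abelian A]

/-! Everything reduces to `Quot(F)`: by well-poweredness and closure under coproducts each `M` has a
largest subobject `N` in `Quot(F)` (`exists_trace`).

From 1 to 2, the fibre product of all extensions of `N` by `Q` is an extension `P` of `N` by a power
`Q^I`. Since `Ext¹(Q^I, Q) = 0`, extensions of `P` by `Q` come from extensions of `N`, and these
split over `P`; so `P` is in `F`, and `P ⟶ N ⟶ M` is the precover (`exists_universal_extension`).
From 2 to 3, the precover of an object of `Quot(F)` is epi with kernel in `F`. From 3 to 1, `Q` is
the kernel of a special epimorphism onto the trace `N` of a cogenerator: if `Ext¹(X, Q) = 0`, the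
torsion part of `X` has no nonzero map to `N`, hence vanishes (`prop_of_ext1Vanishes`).

For the second equivalence, an embedding of `F` into `F^{⊥₁}` can be chosen inside `F ∩ F^{⊥₁}`.
Pullbacks and pushouts in the style of Salce then give completeness, and `Q ⊞ W`, where `W` in `F ∩
F^{⊥₁}` contains the source of the special epimorphism onto `N`, is the quasi-cotilting object. -/

lemma wellPowered_of_hasCoseparator [HasCoseparator A] : WellPowered.{v} A := by
  have h : WellPowered.{v} Aᵒᵖ :=
    wellPowered_of_isSeparator _ ((isSeparator_op_iff _).2 (isCoseparator_coseparator A))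
  exact ⟨fun X => (small_congr (Abelian.subobjectIsoSubobjectOp X).toEquiv).2
    (inferInstanceAs (Small.{v} (Subobject (Opposite.op X))))⟩

end Cocomplete

/-! ### Splittings, pushouts and pullbacks of extensions -/

section Split

variable {C : Type u} [Category.{v} C] [Abelian C]

/-- Over an abelian category, `Ext¹(X, Y)` vanishes when each extension of `X` by `Y` has a
retraction. -/
lemma ext1Vanishes_iff {X Y : C} : Ext1Vanishes X Y ↔
    ∀ ⦃E : C⦄ (i : Y ⟶ E) (p : E ⟶ X) (w : i ≫ p = 0), (ShortComplex.mk i p w).ShortExact →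
      ∃ r : E ⟶ Y, i ≫ r = 𝟙 Y := by
  constructor
  · intro h E i p w hS
    have : Subsingleton (Quotient (extensionSetoid X Y)) := h
    let e : Extension X Y := ⟨E, i, p, w, hS⟩
    let e' : Extension X Y := ⟨Y ⊞ X, biprod.inl, biprod.snd, by simp,
      (ShortComplex.Splitting.ofHasBinaryBiproduct Y X).shortExact⟩
    obtain ⟨φ, h₁, -⟩ := Quotient.exact (s := extensionSetoid X Y)
      (Subsingleton.elim (Quotient.mk (extensionSetoid X Y) e) (Quotient.mk _ e'))
    refine ⟨φ.hom ≫ biprod.fst, ?_⟩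
    have h₁ : i ≫ φ.hom = biprod.inl := h₁
    rw [reassoc_of% h₁]
    simp
  · intro h
    refine ⟨fun a b => ?_⟩
    induction a using Quotient.inductionOn with | _ e
    induction b using Quotient.inductionOn with | _ e'
    refine Quotient.sound (s := extensionSetoid X Y) ?_
    obtain ⟨r, hr⟩ := h _ _ _ e.shortExact
    obtain ⟨r', hr'⟩ := h _ _ _ e'.shortExact
    let s := ShortComplex.Splitting.ofExactOfRetraction _ e.shortExact.exact r hr
      e.shortExact.epi_g
    let s' := ShortComplex.Splitting.ofExactOfRetraction _ e'.shortExact.exact r' hr'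
      e'.shortExact.epi_g
    refine ⟨s.isoBinaryBiproduct ≪≫ s'.isoBinaryBiproduct.symm, ?_, ?_⟩
    · have h₁ : e.i ≫ biprod.lift s.r e.p = biprod.inl := by
        ext
        · simpa using s.f_r
        · simpa using e.zero
      change e.i ≫ biprod.lift s.r e.p ≫ biprod.desc e'.i s'.s = e'.i
      rw [reassoc_of% h₁, biprod.inl_desc]
    · have h₂ : biprod.desc e'.i s'.s ≫ e'.p = biprod.snd := by
        ext
        · simpa using e'.zero
        · simpa using s'.s_g
      change (biprod.lift s.r e.p ≫ biprod.desc e'.i s'.s) ≫ e'.p = e.p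
      rw [Category.assoc, h₂, biprod.lift_snd]

/-- The pushout of a short exact sequence along a morphism out of its left term. -/
lemma shortExact_of_isPushout {S : ShortComplex C} (hS : S.ShortExact) {Y P : C} {h : S.X₁ ⟶ Y}
    {a : S.X₂ ⟶ P} {b : Y ⟶ P} (sq : IsPushout S.f h a b) :
    ∃ (q : P ⟶ S.X₃) (w : b ≫ q = 0), a ≫ q = S.g ∧ (ShortComplex.mk b q w).ShortExact := by
  have := hS.mono_f
  have := hS.epi_g
  have hb : Mono b := (MorphismProperty.monomorphisms C).of_isPushout sq.flip ‹Mono S.f›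
  refine ⟨sq.desc S.g 0 (by simp), by simp, by simp, ?_⟩
  have he : Epi (sq.desc S.g 0 (by simp)) := by
    have : Epi (a ≫ sq.desc S.g 0 (by simp)) := by simpa
    exact epi_of_epi a _
  refine ShortComplex.ShortExact.mk' ?_ hb he
  rw [ShortComplex.exact_iff_exact_up_to_refinements]
  intro T x hx
  obtain ⟨T', π, _, x₂, x₃, e⟩ := sq.hom_eq_add_up_to_refinements x
  have h2 : x₂ ≫ S.g = 0 := by
    have := congr(π ≫ $hx)
    simp at this
    simpa [reassoc_of% e] using this
  obtain ⟨l, rfl⟩ := hS.exact.lift' x₂ h2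
  refine ⟨T', π, inferInstance, l ≫ h + x₃, ?_⟩
  simp [e, sq.w]

/-- The pullback of a short exact sequence along a morphism to its right term. -/
lemma shortExact_of_isPullback {S : ShortComplex C} (hS : S.ShortExact) {Z P : C} {h : Z ⟶ S.X₃}
    {a : P ⟶ S.X₂} {b : P ⟶ Z} (sq : IsPullback a b S.g h) :
    ∃ (j : S.X₁ ⟶ P) (w : j ≫ b = 0), j ≫ a = S.f ∧ (ShortComplex.mk j b w).ShortExact := by
  have := hS.mono_f
  have := hS.epi_g
  have hb : Epi b := (MorphismProperty.epimorphisms C).of_isPullback sq ‹Epi S.g›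
  refine ⟨sq.lift S.f 0 (by simp), by simp, by simp, ?_⟩
  have he : Mono (sq.lift S.f 0 (by simp)) := by
    have : Mono (sq.lift S.f 0 (by simp) ≫ a) := by simpa
    exact mono_of_mono _ a
  refine ShortComplex.ShortExact.mk' ?_ he hb
  rw [ShortComplex.exact_iff_exact_up_to_refinements]
  intro T x hx
  obtain ⟨l, hl⟩ := hS.exact.lift' (x ≫ a) (by simp [sq.w, reassoc_of% hx])
  refine ⟨T, 𝟙 T, inferInstance, l, sq.hom_ext ?_ ?_⟩
  · simp [hl]
  · simpa using hx

/-- A retraction of the pushout extension along `f` restricts to the wanted extension of `f`; this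
and `Ext1Vanishes.lift` replace the long exact sequence. -/
lemma Ext1Vanishes.extend {X Y B D : C} (hV : Ext1Vanishes X Y) {i : B ⟶ D} {p : D ⟶ X}
    {w : i ≫ p = 0} (hS : (ShortComplex.mk i p w).ShortExact) (f : B ⟶ Y) :
    ∃ g : D ⟶ Y, i ≫ g = f := by
  obtain ⟨q, w', h₁, h₂⟩ := shortExact_of_isPushout hS (IsPushout.of_hasPushout i f)
  obtain ⟨r, hr⟩ := ext1Vanishes_iff.1 hV _ _ _ h₂
  exact ⟨pushout.inl i f ≫ r, by simp [pushout.condition_assoc, hr]⟩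

lemma Ext1Vanishes.section {X Y E : C} (hV : Ext1Vanishes X Y) {i : Y ⟶ E} {p : E ⟶ X}
    {w : i ≫ p = 0} (hS : (ShortComplex.mk i p w).ShortExact) : ∃ s : X ⟶ E, s ≫ p = 𝟙 X := by
  obtain ⟨r, hr⟩ := ext1Vanishes_iff.1 hV _ _ _ hS
  exact ⟨_, (ShortComplex.Splitting.ofExactOfRetraction _ hS.exact r hr hS.epi_g).s_g⟩

lemma ext1Vanishes_of_section {X Y : C}
    (h : ∀ ⦃E : C⦄ (i : Y ⟶ E) (p : E ⟶ X) (w : i ≫ p = 0),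
      (ShortComplex.mk i p w).ShortExact → ∃ s : X ⟶ E, s ≫ p = 𝟙 X) : Ext1Vanishes X Y := by
  refine ext1Vanishes_iff.2 fun E i p w hS => ?_
  obtain ⟨s, hs⟩ := h i p w hS
  exact ⟨_, (ShortComplex.Splitting.ofExactOfSection _ hS.exact s hs hS.mono_f).f_r⟩

lemma Ext1Vanishes.lift {X Y E Z : C} (hV : Ext1Vanishes X Y) {i : Y ⟶ E} {p : E ⟶ Z}
    {w : i ≫ p = 0} (hS : (ShortComplex.mk i p w).ShortExact) (f : X ⟶ Z) :
    ∃ g : X ⟶ E, g ≫ p = f := by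
  obtain ⟨q, w', h₁, h₂⟩ := shortExact_of_isPullback hS (IsPullback.of_hasPullback p f)
  obtain ⟨s, hs⟩ := hV.section h₂
  exact ⟨s ≫ pullback.fst p f, by simp [pullback.condition, reassoc_of% hs]⟩

lemma Ext1Vanishes.of_retract_right {X Y Y' : C} (hV : Ext1Vanishes X Y) (r : Retract Y' Y) :
    Ext1Vanishes X Y' := by
  refine ext1Vanishes_iff.2 fun E i p w hS => ?_
  obtain ⟨g, hg⟩ := hV.extend hS r.i
  exact ⟨g ≫ r.r, by simp [reassoc_of% hg]⟩

/-- The projections extend to `E` one at a time and assemble to a retraction, so exactness of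
products is not needed. -/
lemma Ext1Vanishes.of_isLimit_fan {X : C} {J : Type*} {Y : J → C} (c : Fan Y) (hc : IsLimit c)
    (h : ∀ j, Ext1Vanishes X (Y j)) : Ext1Vanishes X c.pt := by
  refine ext1Vanishes_iff.2 fun E i p w hS => ?_
  choose g hg using fun j => (h j).extend hS (c.proj j)
  refine ⟨Fan.IsLimit.lift hc g, Fan.IsLimit.hom_ext hc _ _ fun j => ?_⟩
  simp [hg]

lemma Ext1Vanishes.biprod_right {X Y Z : C} (h : Ext1Vanishes X Y) (h' : Ext1Vanishes X Z) :
    Ext1Vanishes X (Y ⊞ Z) := by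
  refine ext1Vanishes_iff.2 fun E i p w hS => ?_
  obtain ⟨g, hg⟩ := h.extend hS biprod.fst
  obtain ⟨g', hg'⟩ := h'.extend hS biprod.snd
  exact ⟨biprod.lift g g', by ext <;> simp [hg, hg']⟩

lemma shortExact_cokernel {X Y : C} (f : X ⟶ Y) [Mono f] :
    (ShortComplex.mk f (cokernel.π f) (cokernel.condition f)).ShortExact :=
  .mk' (ShortComplex.exact_of_g_is_cokernel _ (cokernelIsCokernel f)) inferInstance inferInstance

lemma shortExact_kernel {X Y : C} (f : X ⟶ Y) [Epi f] :
    (ShortComplex.mk (kernel.ι f) f (kernel.condition f)).ShortExact :=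
  .mk' (ShortComplex.exact_of_f_is_kernel _ (kernelIsKernel f)) inferInstance inferInstance

end Split

/-! ### Epimorphic images -/

section Quot

variable {A : Type u} [Category.{v} A] {F : ObjectProperty A}

lemma quot_of_prop {X : A} (hX : F X) : quot F X := ⟨X, 𝟙 X, hX, inferInstance⟩

lemma quot_of_epi {X Y : A} (f : X ⟶ Y) [Epi f] (hX : quot F X) : quot F Y := by
  obtain ⟨Z, g, hZ, hg⟩ := hX
  exact ⟨Z, g ≫ f, hZ, epi_comp _ _⟩

lemma isClosedUnderQuotients_quot : (quot F).IsClosedUnderQuotients :=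
  ⟨fun f _ hY => quot_of_epi f hY⟩

end Quot

/-! ### Closure properties of `F` and `Quot(F)`; the trace -/

section TorsionFree

variable {A : Type u} [Category.{v} A] [Abelian A] {F : ObjectProperty A}

lemma IsTorsionFreeClass.of_mono (hF : IsTorsionFreeClass F) {X Y : A} (f : X ⟶ Y) [Mono f]
    (hY : F Y) : F X := by
  obtain ⟨T, rfl, -⟩ := hF
  intro Z g hZ
  rw [← cancel_mono f, zero_comp]
  exact hY _ hZ

lemma IsTorsionFreeClass.of_jointly_mono (hF : IsTorsionFreeClass F) {X : A}
    (h : ∀ ⦃Z : A⦄ (g : Z ⟶ X), (∀ ⦃Y : A⦄ (f : X ⟶ Y), F Y → g ≫ f = 0) → g = 0) : F X := by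
  obtain ⟨T, rfl, -⟩ := hF
  exact fun Z g hZ => h g fun Y f hY => hY _ hZ

lemma IsTorsionFreeClass.of_shortExact (hF : IsTorsionFreeClass F) {S : ShortComplex A}
    (hS : S.ShortExact) (h₁ : F S.X₁) (h₃ : F S.X₃) : F S.X₂ := by
  obtain ⟨T, rfl, -⟩ := hF
  intro Z g hZ
  have := hS.mono_f
  obtain ⟨l, rfl⟩ := hS.exact.lift' g (h₃ _ hZ)
  rw [h₁ l hZ, zero_comp]

lemma IsTorsionFreeClass.of_isLimit_fan (hF : IsTorsionFreeClass F) {J : Type*} {Y : J → A}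
    (c : Fan Y) (hc : IsLimit c) (h : ∀ j, F (Y j)) : F c.pt :=
  hF.of_jointly_mono fun _ _ hg => Fan.IsLimit.hom_ext hc _ _ fun j => by
    rw [zero_comp, hg _ (h j)]

lemma IsTorsionFreeClass.of_isZero (hF : IsTorsionFreeClass F) {X : A} (hX : IsZero X) : F X :=
  hF.of_jointly_mono fun _ _ _ => hX.eq_of_tgt _ _

lemma IsTorsionFreeClass.biprod (hF : IsTorsionFreeClass F) {X Y : A} (hX : F X) (hY : F Y) :
    F (X ⊞ Y) :=
  hF.of_jointly_mono fun Z g hg => by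
    ext
    · rw [zero_comp, hg _ hX]
    · rw [zero_comp, hg _ hY]

/-- The preimage of `X` in an object of `F` covering `Y` is again in `F`. -/
lemma IsTorsionFreeClass.quot_of_mono (hF : IsTorsionFreeClass F) {X Y : A} (f : X ⟶ Y) [Mono f]
    (hY : quot F Y) : quot F X := by
  obtain ⟨Z, g, hZ, hg⟩ := hY
  exact ⟨pullback g f, pullback.snd g f, hF.of_mono (pullback.fst g f) hZ, inferInstance⟩

lemma IsTorsionFreeClass.quot_biprod (hF : IsTorsionFreeClass F) {X Y : A} (hX : quot F X)
    (hY : quot F Y) : quot F (X ⊞ Y) := by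
  obtain ⟨Z, g, hZ, hg⟩ := hX
  obtain ⟨Z', g', hZ', hg'⟩ := hY
  exact ⟨_, biprod.map g g', hF.biprod hZ hZ', inferInstance⟩

lemma IsTorsionFreeClass.isClosedUnderSubobjects_quot (hF : IsTorsionFreeClass F) :
    (quot F).IsClosedUnderSubobjects :=
  ⟨fun f _ hY => hF.quot_of_mono f hY⟩

lemma IsTorsionFreeClass.containsZero_quot (hF : IsTorsionFreeClass F) :
    (quot F).ContainsZero :=
  let ⟨Z, hZ⟩ := HasZeroObject.zero (C := A)
  ⟨Z, hZ, quot_of_prop (hF.of_isZero hZ)⟩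

lemma IsTorsionFreeClass.isClosedUnderFiniteProducts_quot (hF : IsTorsionFreeClass F) :
    (quot F).IsClosedUnderFiniteProducts := by
  have := hF.containsZero_quot
  have := hF.isClosedUnderSubobjects_quot
  have : (quot F).IsClosedUnderBinaryProducts := .mk' (by
    rintro _ ⟨G, hG⟩
    refine (quot F).prop_of_iso ?_ (hF.quot_biprod (hG ⟨.left⟩) (hG ⟨.right⟩))
    exact biprod.isoProd _ _ ≪≫ (HasLimit.isoOfNatIso (diagramIsoPair G)).symm)
  exact .mk'

/-- Each object has a largest subobject that is an epimorphic image of an object of `F`. -/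
lemma exists_trace [HasColimits A] [WellPowered.{v} A] (hF : IsClosedUnderCoproducts F) (M : A) :
    ∃ (N : A) (j : N ⟶ M), Mono j ∧ quot F N ∧
      ∀ ⦃Y : A⦄ (f : Y ⟶ M), quot F Y → ∃ g : Y ⟶ N, g ≫ j = f := by
  let S : Type v := Shrink.{v} {s : Subobject M // quot F (s : A)}
  let e : S ≃ {s : Subobject M // quot F (s : A)} := (equivShrink _).symm
  choose G q hG hq using fun s : S => (e s).2
  let d : (∐ G) ⟶ M := Sigma.desc fun s => q s ≫ (e s).1.arrow
  have := hF S
  refine ⟨image d, image.ι d, inferInstance, ⟨∐ G, factorThruImage d,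
    F.prop_colimit _ fun j => hG j.as, inferInstance⟩, fun Y f hY => ?_⟩
  -- The image of `f` is itself one of the subobjects summed up in `d`.
  let s : S := e.symm ⟨imageSubobject f, quot_of_epi (factorThruImageSubobject f) hY⟩
  have hs : (e s).1 = imageSubobject f := by simp [s]
  have h₁ : (e s).1.arrow ≫ cokernel.π (image.ι d) = 0 := by
    have := hq s
    rw [← cancel_epi (q s), comp_zero]
    have : q s ≫ (e s).1.arrow = Sigma.ι G s ≫ factorThruImage d ≫ image.ι d := by simp [d]
    rw [reassoc_of% this, cokernel.condition, comp_zero, comp_zero]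
  have h₂ : f ≫ cokernel.π (image.ι d) = 0 := by
    rw [hs] at h₁
    rw [← imageSubobject_arrow_comp f, Category.assoc, h₁, comp_zero]
  exact (shortExact_cokernel (image.ι d)).exact.lift' f h₂

end TorsionFree

/-! ### Short exact sequences and `Ext¹` in `Quot(F)` -/

section QuotCat

variable {A : Type u} [Category.{v} A] [Abelian A] {F : ObjectProperty A}

/-- Closure under subobjects, quotients and finite products makes the faithful inclusion into `A`
exact, so it preserves and reflects exactness. -/
lemma IsTorsionFreeClass.shortExact_ι_iff (hF : IsTorsionFreeClass F) {X Y E : QuotCat F}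
    {i : Y ⟶ E} {p : E ⟶ X} (w : i ≫ p = 0) (w' : i.hom ≫ p.hom = 0) :
    (ShortComplex.mk i p w).ShortExact ↔ (ShortComplex.mk i.hom p.hom w').ShortExact := by
  have := hF.containsZero_quot
  have := hF.isClosedUnderSubobjects_quot
  have := isClosedUnderQuotients_quot (F := F)
  have := hF.isClosedUnderFiniteProducts_quot
  have h₁ := (quot F).preservesKernels_ι
  have h₂ := (quot F).preservesCokernels_ι
  have := Functor.preservesFiniteLimits_of_preservesKernels (quot F).ι
  have := Functor.preservesFiniteColimits_of_preservesCokernels (quot F).ι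
  constructor
  · intro h
    exact h.map_of_exact (quot F).ι
  · intro h
    have : Mono i.hom := h.mono_f
    have : Epi p.hom := h.epi_g
    exact .mk' (((ShortComplex.mk i p w).exact_map_iff_of_faithful (quot F).ι).1 h.exact)
      ((quot F).ι.mono_of_mono_map ‹_›) ((quot F).ι.epi_of_epi_map ‹_›)

lemma IsTorsionFreeClass.ext1Vanishes_quotCat_iff (hF : IsTorsionFreeClass F) {X Y : QuotCat F} :
    Ext1Vanishes X Y ↔ ∀ ⦃E : A⦄ (i : Y.obj ⟶ E) (p : E ⟶ X.obj) (w : i ≫ p = 0), quot F E →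
      (ShortComplex.mk i p w).ShortExact → ∃ r : E ⟶ Y.obj, i ≫ r = 𝟙 Y.obj := by
  have := hF.containsZero_quot
  have := hF.isClosedUnderSubobjects_quot
  have := isClosedUnderQuotients_quot (F := F)
  have := hF.isClosedUnderFiniteProducts_quot
  refine (ext1Vanishes_iff (C := QuotCat F)).trans ⟨fun h E i p w hE hS => ?_,
    fun h E i p w hS => ?_⟩
  · obtain ⟨r, hr⟩ := h (E := ⟨E, hE⟩) (ObjectProperty.homMk i) (ObjectProperty.homMk p)
      (by ext; exact w) ((hF.shortExact_ι_iff _ w).2 hS)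
    exact ⟨r.hom, congr($(hr).hom)⟩
  · obtain ⟨r, hr⟩ := h i.hom p.hom congr($(w).hom) E.property ((hF.shortExact_ι_iff w _).1 hS)
    exact ⟨ObjectProperty.homMk r, by ext; exact hr⟩

end QuotCat

/-! ### Diagram lemmas -/

section Diagrams

variable {A : Type u} [Category.{v} A] [Abelian A]

lemma epi_biprod_desc_of_shortExact {S : ShortComplex A} (hS : S.ShortExact) {Z : A}
    (g : Z ⟶ S.X₂) [Epi (g ≫ S.g)] : Epi (biprod.desc S.f g) := by
  refine Preadditive.epi_of_cancel_zero _ fun {T} h hh => ?_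
  have := hS.epi_g
  have h₁ : S.f ≫ h = 0 := by simpa using biprod.inl ≫= hh
  have h₂ : g ≫ h = 0 := by simpa using biprod.inr ≫= hh
  obtain ⟨h', rfl⟩ := hS.exact.desc' h h₁
  have : h' = 0 := by
    rw [← cancel_epi (g ≫ S.g), comp_zero, Category.assoc]
    exact h₂
  rw [this, comp_zero]

/-- If `K ⟶ P` lifts along `E ⟶ P`, then an extension `Q ⟶ E ⟶ P` induces an extension of the
cokernel of `K ⟶ P` by `Q`. -/
lemma shortExact_cokernel_of_lift {Q E P K M : A} {i : Q ⟶ E} {p : E ⟶ P} {w : i ≫ p = 0}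
    (hE : (ShortComplex.mk i p w).ShortExact) {k : K ⟶ P} {b : P ⟶ M} {w' : k ≫ b = 0}
    (hP : (ShortComplex.mk k b w').ShortExact) (u : K ⟶ E) (hu : u ≫ p = k) :
    ∃ (p' : cokernel u ⟶ M) (w'' : (i ≫ cokernel.π u) ≫ p' = 0), cokernel.π u ≫ p' = p ≫ b ∧
      (ShortComplex.mk (i ≫ cokernel.π u) p' w'').ShortExact := by
  have hi : Mono i := hE.mono_f
  have hp : Epi p := hE.epi_g
  have hk : Mono k := hP.mono_f
  have hb : Epi b := hP.epi_g
  have hu' : Mono u := by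
    have : Mono (u ≫ p) := hu ▸ hk
    exact mono_of_mono u p
  have hcok := shortExact_cokernel u
  refine ⟨cokernel.desc u (p ≫ b) (by rw [reassoc_of% hu, w']), by simp [reassoc_of% w], by simp,
    .mk' ?_ ?_ ?_⟩
  · rw [ShortComplex.exact_iff_exact_up_to_refinements]
    intro T x hx
    obtain ⟨T', π, _, y, hy⟩ := surjective_up_to_refinements_of_epi (cokernel.π u) x
    have h₁ : (y ≫ p) ≫ b = 0 := by
      have := π ≫= hx
      simp only [reassoc_of% hy, cokernel.π_desc, comp_zero] at this
      simpa using this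
    obtain ⟨l, hl⟩ := hP.exact.lift' (y ≫ p) h₁
    obtain ⟨c, hc⟩ := hE.exact.lift' (y - l ≫ u) (by simpa [hu, sub_eq_zero] using hl.symm)
    refine ⟨T', π, inferInstance, c, ?_⟩
    have hc : c ≫ i = y - l ≫ u := hc
    simp [reassoc_of% hc, hy]
  · refine Preadditive.mono_of_cancel_zero _ fun {T} x hx => ?_
    obtain ⟨l, hl⟩ := hcok.exact.lift' (x ≫ i) (by simpa using hx)
    have hl : l ≫ u = x ≫ i := hl
    have : l ≫ k = 0 := by rw [← hu, reassoc_of% hl, w, comp_zero]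
    obtain rfl := zero_of_comp_mono _ this
    rw [zero_comp] at hl
    exact zero_of_comp_mono _ hl.symm
  · have : Epi (cokernel.π u ≫ cokernel.desc u (p ≫ b) (by rw [reassoc_of% hu, w'])) := by
      rw [cokernel.π_desc]
      exact epi_comp _ _
    exact epi_of_epi (cokernel.π u) _

/-- The pushout of a quotient `f` of the left term of a short exact sequence with inclusion `m`:
the second projection has the same kernel as `f`. -/
lemma shortExact_of_isPushout_epi {Y B C W D P : A} {y : Y ⟶ B} {f : B ⟶ C} {w : y ≫ f = 0}
    (hB : (ShortComplex.mk y f w).ShortExact) {m : B ⟶ W} {d : W ⟶ D} {w' : m ≫ d = 0}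
    (hW : (ShortComplex.mk m d w').ShortExact) {a : W ⟶ P} {c : C ⟶ P}
    (sq : IsPushout m f a c) :
    ∃ w'' : (y ≫ m) ≫ a = 0, (ShortComplex.mk (y ≫ m) a w'').ShortExact := by
  have hy : Mono y := hB.mono_f
  have hf : Epi f := hB.epi_g
  have hm : Mono m := hW.mono_f
  have ha : Epi a := (MorphismProperty.epimorphisms A).of_isPushout sq hf
  obtain ⟨q, w₁, h₁, h₂⟩ := shortExact_of_isPushout hW sq
  have hc : Mono c := h₂.mono_f
  have h₁ : a ≫ q = d := h₁
  refine ⟨by rw [Category.assoc, sq.w, reassoc_of% w, zero_comp], .mk' ?_ (mono_comp _ _) ha⟩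
  rw [ShortComplex.exact_iff_exact_up_to_refinements]
  intro T x hx
  have hx : x ≫ a = 0 := hx
  obtain ⟨l, rfl⟩ := hW.exact.lift' x (by
    change x ≫ d = 0
    rw [← h₁, reassoc_of% hx, zero_comp])
  obtain ⟨l', rfl⟩ := hB.exact.lift' l (by
    change l ≫ f = 0
    rw [← cancel_mono c, zero_comp, Category.assoc, ← sq.w, ← Category.assoc]
    exact hx)
  exact ⟨T, 𝟙 T, inferInstance, l', by simp⟩

/-- The pullback of an epimorphism along the inclusion of a short exact sequence. -/
lemma shortExact_of_isPullback_mono {B E X Z K : A} {i : B ⟶ E} {p : E ⟶ X} {w : i ≫ p = 0}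
    (hS : (ShortComplex.mk i p w).ShortExact) {f : Z ⟶ E} [Epi f] {a : K ⟶ Z} {b : K ⟶ B}
    (sq : IsPullback a b f i) :
    ∃ w' : a ≫ f ≫ p = 0, (ShortComplex.mk a (f ≫ p) w').ShortExact := by
  have hi : Mono i := hS.mono_f
  have hp : Epi p := hS.epi_g
  have ha : Mono a := (MorphismProperty.monomorphisms A).of_isPullback sq.flip hi
  refine ⟨by rw [reassoc_of% sq.w, w, comp_zero], .mk' ?_ ha (epi_comp _ _)⟩
  rw [ShortComplex.exact_iff_exact_up_to_refinements]
  intro T x hx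
  obtain ⟨l, hl⟩ := hS.exact.lift' (x ≫ f) (by simpa using hx)
  exact ⟨T, 𝟙 T, inferInstance, sq.lift x l hl.symm, by simp⟩

/-- Let `K` be the pullback of an epimorphism `e` along `n`, and let its second projection lift to
`P` along an epimorphism `φ`. Then the pushout of `K ⟶ Z` and of the lift `K ⟶ P` maps onto the
target of `e`, with the same kernel as `φ`. -/
lemma shortExact_of_isPullback_of_isPushout {Q P N B Z K D : A} {i : Q ⟶ P} {φ : P ⟶ N}
    {w : i ≫ φ = 0} (hS : (ShortComplex.mk i φ w).ShortExact) {e : Z ⟶ B} [Epi e] {n : N ⟶ B}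
    {a : K ⟶ Z} {b : K ⟶ N} (sq : IsPullback a b e n) {b' : K ⟶ P} (hb' : b' ≫ φ = b)
    {r : Z ⟶ D} {s : P ⟶ D} (sq' : IsPushout a b' r s) [Mono s] :
    ∃ (d : D ⟶ B) (w' : (i ≫ s) ≫ d = 0), (ShortComplex.mk (i ≫ s) d w').ShortExact := by
  let d := sq'.desc e (φ ≫ n) (by rw [sq.w, ← hb', Category.assoc])
  have hd₁ : r ≫ d = e := sq'.inl_desc ..
  have hd₂ : s ≫ d = φ ≫ n := sq'.inr_desc ..
  have hi : Mono i := hS.mono_f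
  have hd : Epi d := by
    have : Epi (r ≫ d) := by rwa [hd₁]
    exact epi_of_epi r d
  refine ⟨d, by rw [Category.assoc, hd₂, reassoc_of% w, zero_comp], .mk' ?_ (mono_comp _ _) hd⟩
  rw [ShortComplex.exact_iff_exact_up_to_refinements]
  intro T x hx
  have hx : x ≫ d = 0 := hx
  obtain ⟨T', π, _, z, f, hf⟩ := sq'.hom_eq_add_up_to_refinements x
  have h₁ : z ≫ e = (-(f ≫ φ)) ≫ n := by
    have := π ≫= hx
    rw [reassoc_of% hf] at this
    simp only [Preadditive.add_comp, Category.assoc, hd₁, hd₂, comp_zero] at this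
    rw [Preadditive.neg_comp, Category.assoc]
    exact eq_neg_of_add_eq_zero_left this
  -- Through `K`, the part of `x` coming from `Z` can be moved into `P`; the resulting `f + h ≫ b'`
  -- is killed by `φ`.
  let h := sq.lift z (-(f ≫ φ)) h₁
  obtain ⟨l, hl⟩ := hS.exact.lift' (f + h ≫ b') (by
    change (f + h ≫ b') ≫ φ = 0
    simp [hb', h])
  have hl : l ≫ i = f + h ≫ b' := hl
  refine ⟨T', π, inferInstance, l, ?_⟩
  have h₂ : h ≫ b' ≫ s = z ≫ r := by rw [← sq'.w, ← Category.assoc, sq.lift_fst]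
  change π ≫ x = l ≫ i ≫ s
  rw [reassoc_of% hl, hf, Preadditive.add_comp, ← h₂, add_comm, Category.assoc h]

end Diagrams

/-! ### Equivalence of the three assertions on precovers -/

section Precover

variable {A : Type u} [Category.{v} A] [Abelian A] {F : ObjectProperty A}

/-- `P` is the fibre product over `M` of one extension from each class, with kernel `K = Q^I`.
Infinite products need not be exact, so `P ⟶ M` is shown to be epi by lifting `Z ⟶ M`, with `Z` in
`F`, to every extension. -/
lemma exists_universal_extension [HasLimits A] (hA : IsExt1Small A) (hF : IsTorsionFreeClass F)
    {Q : A} (hQ : F Q) (hFQ : ∀ X, F X → Ext1Vanishes X Q) {M : A} (hM : quot F M) :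
    ∃ (K P : A) (k : K ⟶ P) (b : P ⟶ M) (w : k ≫ b = 0), (ShortComplex.mk k b w).ShortExact ∧
      quot F P ∧ Ext1Vanishes P Q ∧ rightPerp1 F K := by
  have := hA M Q
  let I : Type v := Shrink.{v} (Ext1 M Q)
  let e (j : I) : Extension M Q := Quotient.out (s := extensionSetoid M Q)
    ((equivShrink (Ext1 M Q)).symm j)
  let P : A := widePullback M (fun j => (e j).E) (fun j => (e j).p)
  let pr (j : I) : P ⟶ (e j).E := WidePullback.π (fun j => (e j).p) j
  let b : P ⟶ M := WidePullback.base (fun j => (e j).p)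
  have hpr (j : I) : pr j ≫ (e j).p = b := WidePullback.π_arrow _ j
  let K : A := ∏ᶜ fun _ : I => Q
  let k : K ⟶ P := WidePullback.lift 0 (fun j => Pi.π _ j ≫ (e j).i) (by simp [(e _).zero])
  have hkp (j : I) : k ≫ pr j = Pi.π _ j ≫ (e j).i := WidePullback.lift_π ..
  have hkb : k ≫ b = 0 := WidePullback.lift_base ..
  have hmono (j : I) : Mono (e j).i := (e j).shortExact.mono_f
  obtain ⟨Z, f, hZ, hf⟩ := hM
  choose g hg using fun j => (hFQ Z hZ).lift (e j).shortExact f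
  let l : Z ⟶ P := WidePullback.lift f g hg
  have hl : l ≫ b = f := WidePullback.lift_base ..
  have hS : (ShortComplex.mk k b hkb).ShortExact := by
    refine .mk' ?_ ?_ ?_
    · rw [ShortComplex.exact_iff_exact_up_to_refinements]
      intro T x hx
      have hx : x ≫ b = 0 := hx
      choose y hy using fun j => (e j).shortExact.exact.lift' (x ≫ pr j) (by
        change (x ≫ pr j) ≫ (e j).p = 0
        rw [Category.assoc, hpr, hx])
      refine ⟨T, 𝟙 T, inferInstance, Pi.lift y, ?_⟩
      refine WidePullback.hom_ext (fun j => (e j).p) _ _ (fun j => ?_) ?_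
      · change (𝟙 T ≫ x) ≫ pr j = (Pi.lift y ≫ k) ≫ pr j
        rw [Category.assoc, Category.assoc, hkp, Pi.lift_π_assoc, Category.id_comp]
        exact (hy j).symm
      · change (𝟙 T ≫ x) ≫ b = (Pi.lift y ≫ k) ≫ b
        rw [Category.assoc, Category.assoc, hkb, hx, comp_zero, comp_zero]
    · refine Preadditive.mono_of_cancel_zero _ fun {T} x hx => Pi.hom_ext _ _ fun j => ?_
      rw [zero_comp, ← cancel_mono (e j).i, zero_comp, Category.assoc, ← hkp, reassoc_of% hx,
        zero_comp]
    · have : Epi (l ≫ b) := hl ▸ hf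
      exact epi_of_epi l b
  have hFK : F K := hF.of_isLimit_fan _ (productIsProduct fun _ : I => Q) fun _ => hQ
  refine ⟨K, P, k, b, hkb, hS, ?_, ?_, fun X hX =>
    Ext1Vanishes.of_isLimit_fan _ (productIsProduct fun _ : I => Q) fun _ => hFQ X hX⟩
  · have : Epi (l ≫ (ShortComplex.mk k b hkb).g) := hl ▸ hf
    exact ⟨_, _, hF.biprod hFK hZ, epi_biprod_desc_of_shortExact hS l⟩
  · refine ext1Vanishes_iff.2 fun E i p w hE => ?_
    -- `E` splits over `K`, so dividing by `K` yields an extension of `M` by `Q`, equivalent to some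
    -- `e j`.
    obtain ⟨t, ht⟩ := (hFQ K hFK).lift hE k
    obtain ⟨p', w', hp', hE'⟩ := shortExact_cokernel_of_lift hE hS t ht
    let e' : Extension M Q := ⟨_, _, p', w', hE'⟩
    let j : I := equivShrink (Ext1 M Q) (Quotient.mk (extensionSetoid M Q) e')
    obtain ⟨φ, -, h₂⟩ : extensionSetoid M Q (e j) e' := by
      refine Quotient.exact (s := extensionSetoid M Q) ((Quotient.out_eq _).trans ?_)
      exact (equivShrink (Ext1 M Q)).symm_apply_apply _
    have h₂ : φ.hom ≫ p' = (e j).p := h₂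
    have := hE'.mono_f
    -- Both maps agree over `M`, so their difference lands in `Q`; the second vanishes on `Q`, so
    -- the difference is a retraction.
    obtain ⟨r, hr⟩ := hE'.exact.lift' (cokernel.π t - p ≫ pr j ≫ φ.hom) (by
      change (cokernel.π t - p ≫ pr j ≫ φ.hom) ≫ p' = 0
      simp [hp', h₂, hpr])
    have hr : r ≫ i ≫ cokernel.π t = cokernel.π t - p ≫ pr j ≫ φ.hom := hr
    refine ⟨r, ?_⟩
    have hm : Mono (i ≫ cokernel.π t) := hE'.mono_f
    rw [← cancel_mono (i ≫ cokernel.π t), Category.assoc, hr, Preadditive.comp_sub,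
      reassoc_of% w, zero_comp, sub_zero, Category.id_comp]

lemma isSemiSpecialPrecovering_of_eq [HasLimits A] [HasColimits A] [WellPowered.{v} A]
    (hA : IsExt1Small A) (hF : IsTorsionFreeClass F) (hc : IsClosedUnderCoproducts F) {Q : A}
    (hQ : F Q) (h : F = quot F ⊓ leftPerp1Obj Q) : IsSemiSpecialPrecovering F := by
  intro M
  have hFQ : ∀ X, F X → Ext1Vanishes X Q := fun X hX => by
    rw [h] at hX
    exact hX.2
  obtain ⟨N, j, hj, hN, hfac⟩ := exists_trace hc M
  obtain ⟨K, P, k, b, w, hS, hP, hPQ, hK⟩ := exists_universal_extension hA hF hQ hFQ hN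
  refine ⟨P, b ≫ j, ?_, fun Y g hY => ?_, fun X hX => ?_⟩
  · rw [h]
    exact ⟨hP, hPQ⟩
  · obtain ⟨g', rfl⟩ := hfac g (quot_of_prop hY)
    obtain ⟨g'', rfl⟩ := (hK Y hY).lift hS g'
    exact ⟨g'', by simp⟩
  · have := hS.mono_f
    refine (hK X hX).of_retract_right (Retract.ofIso ?_)
    exact IsLimit.conePointUniqueUpToIso (kernelIsKernel (b ≫ j))
      (isKernelCompMono hS.fIsKernel j rfl)

/-- The injections into a coproduct lift to its precover, which makes the coproduct a subobject of
the precover. -/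
lemma IsSemiSpecialPrecovering.isClosedUnderCoproducts (h : IsSemiSpecialPrecovering F)
    (hF : IsTorsionFreeClass F) : IsClosedUnderCoproducts F := by
  refine fun I => ⟨fun M ⟨c⟩ => ?_⟩
  obtain ⟨P, f, hP, hlift, -⟩ := h M
  choose g hg using fun j => hlift _ (c.ι.app j) (c.prop_diag_obj j)
  let s : M ⟶ P := c.isColimit.desc (Cocone.mk P (Discrete.natTrans g))
  have hs : s ≫ f = 𝟙 M := by
    refine c.isColimit.hom_ext fun j => ?_
    have : c.ι.app j ≫ s = g j := c.isColimit.fac _ j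
    change c.ι.app j ≫ s ≫ f = c.ι.app j ≫ 𝟙 M
    rw [reassoc_of% this, hg]
    exact (Category.comp_id _).symm
  have : Mono (s ≫ f) := hs ▸ inferInstance
  have := mono_of_mono s f
  exact hF.of_mono s hP

lemma IsSemiSpecialPrecovering.exists_shortExact (h : IsSemiSpecialPrecovering F)
    (hF : IsTorsionFreeClass F) {M : A} (hM : quot F M) :
    ∃ (Y P : A) (i : Y ⟶ P) (p : P ⟶ M) (w : i ≫ p = 0), (ShortComplex.mk i p w).ShortExact ∧
      F P ∧ F Y ∧ rightPerp1 F Y := by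
  obtain ⟨P, f, hP, hlift, hker⟩ := h M
  obtain ⟨Z, g, hZ, hg⟩ := hM
  obtain ⟨g', rfl⟩ := hlift Z g hZ
  have := epi_of_epi g' f
  exact ⟨_, _, _, f, _, shortExact_kernel f, hP, hF.of_mono (kernel.ι f) hP, hker⟩

lemma IsTorsionFreeClass.kerExt1InQuot_of_rightPerp1 (hF : IsTorsionFreeClass F) {Y : QuotCat F}
    (hY : rightPerp1 F Y.obj) : kerExt1InQuot F Y := fun _ hX =>
  hF.ext1Vanishes_quotCat_iff.2 fun _ i p w _ hS => ext1Vanishes_iff.1 (hY _ hX) i p w hS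

/-- As `F` is closed under extensions, all extensions in `A` of objects of `F` by `Y` already lie in
`Quot(F)`. This uses that `Y` is in `F`. -/
lemma IsTorsionFreeClass.rightPerp1_of_kerExt1InQuot (hF : IsTorsionFreeClass F) {Y : QuotCat F}
    (hY : F Y.obj) (h : kerExt1InQuot F Y) : rightPerp1 F Y.obj := fun X hX =>
  ext1Vanishes_iff.2 fun _ i p w hS => hF.ext1Vanishes_quotCat_iff.1
    (h ⟨X, quot_of_prop hX⟩ hX) i p w (quot_of_prop (hF.of_shortExact hS hY hX)) hS

lemma IsSemiSpecialPrecovering.isLeftCompleteCotorsionPair (h : IsSemiSpecialPrecovering F)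
    (hF : IsTorsionFreeClass F) :
    IsLeftCompleteCotorsionPair (inQuot F) (kerExt1InQuot F) := by
  refine ⟨⟨rfl, le_antisymm (fun X hX Y hY => hY X hX) fun X hX => ?_⟩, fun X => ?_⟩
  · obtain ⟨Y, P, i, p, w, hS, hP, hY, hYF⟩ := h.exists_shortExact hF X.property
    obtain ⟨r, hr⟩ := hF.ext1Vanishes_quotCat_iff.1 (hX ⟨Y, quot_of_prop hY⟩
      (hF.kerExt1InQuot_of_rightPerp1 hYF)) i p w (quot_of_prop hP) hS
    let s := ShortComplex.Splitting.ofExactOfRetraction _ hS.exact r hr hS.epi_g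
    have hs : s.s ≫ p = 𝟙 X.obj := s.s_g
    have : Mono (s.s ≫ p) := hs ▸ inferInstance
    have := mono_of_mono s.s p
    exact hF.of_mono s.s hP
  · obtain ⟨Y, P, i, p, w, hS, hP, hY, hYF⟩ := h.exists_shortExact hF X.property
    exact ⟨⟨Y, quot_of_prop hY⟩, ⟨P, quot_of_prop hP⟩, ObjectProperty.homMk i,
      ObjectProperty.homMk p, by ext; exact w, (hF.shortExact_ι_iff _ w).2 hS, hP,
      hF.kerExt1InQuot_of_rightPerp1 hYF⟩

/-- If `Q` is the kernel of an epimorphism from an object of `F` to an object of `quot F` that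
cogenerates the torsion objects of `quot F`, then `^{⊥₁}Q` detects `F` within `quot F`. -/
lemma IsTorsionFreeClass.prop_of_ext1Vanishes (hF : IsTorsionFreeClass F) {Q P N : A}
    {i : Q ⟶ P} {φ : P ⟶ N} {w : i ≫ φ = 0} (hS : (ShortComplex.mk i φ w).ShortExact)
    (hP : F P) (hN : quot F N) (hFQ : ∀ X, F X → Ext1Vanishes X Q)
    (hcog : ∀ T, quot F T → (∀ g : T ⟶ N, g = 0) → IsZero T) {X : A} (hX : quot F X)
    (hXQ : Ext1Vanishes X Q) : F X := by
  obtain ⟨T, hT, hT', hex⟩ := id hF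
  obtain ⟨T₀, F₀, t, q, wt, ht, hT₀, hF₀⟩ := hex X
  have hmt : Mono t := ht.mono_f
  suffices IsZero T₀ from hF.of_shortExact ht (hF.of_isZero this) hF₀
  refine hcog T₀ (hF.quot_of_mono t hX) fun g => ?_
  have sq := IsPushout.of_hasPushout t g
  obtain ⟨q', w', -, hS'⟩ := shortExact_of_isPushout ht sq
  have hn : Mono (pushout.inr t g) := hS'.mono_f
  have hX' : quot F (pushout t g) := by
    have : Epi (biprod.desc (pushout.inl t g) (pushout.inr t g)) :=
      Preadditive.epi_of_cancel_zero _ fun {Z} h hh => by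
        apply pushout.hom_ext
        · simpa using biprod.inl ≫= hh
        · simpa using biprod.inr ≫= hh
    exact quot_of_epi (biprod.desc (pushout.inl t g) (pushout.inr t g)) (hF.quot_biprod hX hN)
  obtain ⟨F', e, hF', he⟩ := hX'
  have sq' := IsPullback.of_hasPullback e (pushout.inr t g)
  obtain ⟨w₁, h₁⟩ := shortExact_of_isPullback_mono hS' sq'
  have hma : Mono (pullback.fst e (pushout.inr t g)) := h₁.mono_f
  -- The goal is an object of `F` mapping onto the pushout of `t` and `g` with kernel `Q`: an
  -- extension of `F₀` by `P`, pushed out from the extension of `F₀` by the pullback.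
  obtain ⟨b', hb'⟩ := (hFQ _ (hF.of_mono (pullback.fst e (pushout.inr t g)) hF')).lift hS
    (pullback.snd e (pushout.inr t g))
  have sq₂ := IsPushout.of_hasPushout (pullback.fst e (pushout.inr t g)) b'
  obtain ⟨q₂, w₂, -, h₂⟩ := shortExact_of_isPushout h₁ sq₂
  have hF'' : F (pushout (pullback.fst e (pushout.inr t g)) b') := hF.of_shortExact h₂ hP hF₀
  have := h₂.mono_f
  obtain ⟨d, w₃, h₃⟩ := shortExact_of_isPullback_of_isPushout hS sq' hb' sq₂
  -- `X` now maps to an object of `F`, where the torsion part `T₀` dies; this forces `g = 0`.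
  obtain ⟨s, hs⟩ := hXQ.lift h₃ (pushout.inl t g)
  have h₅ : t ≫ s = 0 := by
    rw [← hT] at hF''
    exact hF'' _ hT₀
  rw [← cancel_mono (pushout.inr t g), zero_comp, ← sq.w, ← hs, reassoc_of% h₅, zero_comp]

lemma exists_eq_of_isLeftCompleteCotorsionPair [HasColimits A] [WellPowered.{v} A]
    [HasCoseparator A] (hF : IsTorsionFreeClass F) (hc : IsClosedUnderCoproducts F)
    (h : IsLeftCompleteCotorsionPair (inQuot F) (kerExt1InQuot F)) :
    ∃ Q : A, F Q ∧ F = quot F ⊓ leftPerp1Obj Q := by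
  obtain ⟨N, j, hj, hN, hfac⟩ := exists_trace hc (coseparator A)
  obtain ⟨Q, P, i, p, w, hS, hP, hQ⟩ := h.2 ⟨N, hN⟩
  have w' : i.hom ≫ p.hom = 0 := congr($(w).hom)
  have hS' := (hF.shortExact_ι_iff w w').1 hS
  have hi : Mono i.hom := hS'.mono_f
  have hFQ : F Q.obj := hF.of_mono i.hom hP
  have hQ' := hF.rightPerp1_of_kerExt1InQuot hFQ hQ
  refine ⟨Q.obj, hFQ, le_antisymm (fun X hX => ⟨quot_of_prop hX, hQ' X hX⟩) fun X hX =>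
    hF.prop_of_ext1Vanishes hS' hP hN hQ' (fun T hT hg => ?_) hX.1 hX.2⟩
  refine (IsZero.iff_id_eq_zero _).2 ((isCoseparator_coseparator A).def _ _ fun f => ?_)
  obtain ⟨g, rfl⟩ := hfac f hT
  simp [hg g]

end Precover

/-! ### Completeness of the cotorsion pair and cogeneration by `F^{⊥₁}` -/

section Complete

variable {A : Type u} [Category.{v} A] [Abelian A] {F : ObjectProperty A}

/-- The source of an `F`-precover of an object of `F^{⊥₁}` with kernel in `F^{⊥₁}` is in
`F^{⊥₁}`. -/
lemma IsTorsionFreeClass.rightPerp1_of_lift (hF : IsTorsionFreeClass F) {K P W : A} {k : K ⟶ P}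
    {φ : P ⟶ W} {w : k ≫ φ = 0} (hS : (ShortComplex.mk k φ w).Exact) [Mono k] (hP : F P)
    (hlift : ∀ (Y : A) (g : Y ⟶ W), F Y → ∃ h : Y ⟶ P, h ≫ φ = g)
    (hK : rightPerp1 F K) (hW : rightPerp1 F W) : rightPerp1 F P := by
  refine fun X hX => ext1Vanishes_iff.2 fun E i p w hE => ?_
  obtain ⟨f, hf⟩ := (hW X hX).extend hE φ
  obtain ⟨h, hh⟩ := hlift E f (hF.of_shortExact hE hP hX)
  -- `h` is a retraction only up to an error in `K`, which extends to `E` and is subtracted.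
  obtain ⟨d, hd⟩ := hS.lift' (i ≫ h - 𝟙 P) (by
    change (i ≫ h - 𝟙 P) ≫ φ = 0
    simp [hh, hf])
  have hd : d ≫ k = i ≫ h - 𝟙 P := hd
  obtain ⟨d', rfl⟩ := (hK X hX).extend hE d
  exact ⟨h - d' ≫ k, by rw [Preadditive.comp_sub, ← Category.assoc i d', hd, sub_sub_cancel]⟩

/-- If `Y` and `W` are in `F^{⊥₁}`, then the quotient `P` of `W` by `Y` is right
`Ext¹`-orthogonal to `F` in the category `quot F`. -/
lemma IsTorsionFreeClass.kerExt1InQuot_of_shortExact (hF : IsTorsionFreeClass F) {Y W P : A}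
    {y : Y ⟶ W} {ψ : W ⟶ P} {w : y ≫ ψ = 0} (hS : (ShortComplex.mk y ψ w).ShortExact)
    (hY : rightPerp1 F Y) (hW : rightPerp1 F W) (hP : quot F P) : kerExt1InQuot F ⟨P, hP⟩ := by
  refine fun X hX => hF.ext1Vanishes_quotCat_iff.2 fun E i p w' ⟨Z, f, hZ, hf⟩ hE => ?_
  have sq := IsPullback.of_hasPullback f i
  have hi : Mono i := hE.mono_f
  have hb : Epi (pullback.snd f i) := inferInstance
  obtain ⟨w₁, h₁⟩ := shortExact_of_isPullback_mono hE sq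
  -- Over the cover `Z` of `E` all objects are in `F`, so orthogonality of `Y` and `W` in `A`
  -- applies; the result then descends to `E`.
  obtain ⟨c, hc⟩ := (hY _ (hF.of_mono (pullback.fst f i) hZ)).lift hS (pullback.snd f i)
  obtain ⟨g, hg⟩ := (hW X.obj hX).extend h₁ c
  obtain ⟨r, hr⟩ := (shortExact_kernel f).exact.desc' (g ≫ ψ) (by
    change kernel.ι f ≫ g ≫ ψ = 0
    have : sq.lift (kernel.ι f) 0 (by simp) ≫ pullback.fst f i = kernel.ι f := sq.lift_fst ..
    rw [← this, Category.assoc, reassoc_of% hg, hc, sq.lift_snd])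
  have hr : f ≫ r = g ≫ ψ := hr
  refine ⟨r, ?_⟩
  rw [← cancel_epi (pullback.snd f i), ← pullback.condition_assoc, hr, reassoc_of% hg, hc,
    Category.comp_id]

/-- An embedding of `X` into an object of `F^{⊥₁}` lifts to the precover of that object, which is
still in `F^{⊥₁}`. -/
lemma IsSemiSpecialPrecovering.exists_mono (h : IsSemiSpecialPrecovering F)
    (hF : IsTorsionFreeClass F) (hc : Cogenerates (rightPerp1 F) F) {X : A} (hX : F X) :
    ∃ (W : A) (m : X ⟶ W), Mono m ∧ F W ∧ rightPerp1 F W := by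
  obtain ⟨W₀, m₀, hW₀, hm₀⟩ := hc X hX
  obtain ⟨W, φ, hW, hlift, hK⟩ := h W₀
  obtain ⟨m, rfl⟩ := hlift X m₀ hX
  exact ⟨W, m, mono_of_mono m φ, hW, hF.rightPerp1_of_lift
    (k := kernel.ι φ) (w := kernel.condition φ)
    (ShortComplex.exact_of_f_is_kernel _ (kernelIsKernel φ)) hW hlift hK hW₀⟩

/-- Salce's argument: `W` is the pullback of `P ⟶ P/X` and a special epimorphism `Z ⟶ P/X`. It is an
extension of `Z` by `X`, and also of `P` by the kernel `Y`. -/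
lemma IsSemiSpecialPrecovering.exists_shortExact_of_cogenerates (h : IsSemiSpecialPrecovering F)
    (hF : IsTorsionFreeClass F) (hc : Cogenerates (rightPerp1 F) F) {X : A} (hX : F X) :
    ∃ (W Z : A) (i : X ⟶ W) (p : W ⟶ Z) (w : i ≫ p = 0), (ShortComplex.mk i p w).ShortExact ∧
      F W ∧ rightPerp1 F W ∧ F Z := by
  obtain ⟨P, m, hm, hP, hP'⟩ := h.exists_mono hF hc hX
  obtain ⟨Y, Z, j, q, w, hS, hZ, hY, hY'⟩ := h.exists_shortExact hF
    (quot_of_epi (cokernel.π m) (quot_of_prop hP))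
  have sq := IsPullback.of_hasPullback (cokernel.π m) q
  obtain ⟨i, w', -, hi⟩ := shortExact_of_isPullback (shortExact_cokernel m) sq
  obtain ⟨k, w'', -, hk⟩ := shortExact_of_isPullback hS sq.flip
  have hW := hF.of_shortExact hi hX hZ
  have := hk.mono_f
  exact ⟨_, Z, i, _, w', hi, hW, hF.rightPerp1_of_lift hk.exact hW
    (fun V g hV => (hY' V hV).lift hk g) hY' hP', hZ⟩

/-- For `X = B/Y` with `B` in `F`, embed `B` in `W` with cokernel in `F` and push out: `X` embeds in
`W/Y`, which is orthogonal to `F` at least within `Quot(F)`. -/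
lemma IsSemiSpecialPrecovering.isCompleteCotorsionPair (h : IsSemiSpecialPrecovering F)
    (hF : IsTorsionFreeClass F) (hc : Cogenerates (rightPerp1 F) F) :
    IsCompleteCotorsionPair (inQuot F) (kerExt1InQuot F) := by
  have hl := h.isLeftCompleteCotorsionPair hF
  refine ⟨hl, hl.1, fun X => ?_⟩
  obtain ⟨Y, B, y, f, w, hS, hB, hY, hY'⟩ := h.exists_shortExact hF X.property
  obtain ⟨W, Z, i, p, w', hS', hW, hW', hZ⟩ := h.exists_shortExact_of_cogenerates hF hc hB
  have sq := IsPushout.of_hasPushout i f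
  obtain ⟨q, w₁, -, h₁⟩ := shortExact_of_isPushout hS' sq
  obtain ⟨w₂, h₂⟩ := shortExact_of_isPushout_epi hS hS' sq
  have := h₂.epi_g
  have hP : quot F (pushout i f) := quot_of_epi (pushout.inl i f) (quot_of_prop hW)
  exact ⟨⟨_, hP⟩, ⟨Z, quot_of_prop hZ⟩, ObjectProperty.homMk (pushout.inr i f),
    ObjectProperty.homMk q, by ext; exact w₁, (hF.shortExact_ι_iff _ w₁).2 h₁, hZ,
    hF.kerExt1InQuot_of_shortExact h₂ hY' hW' hP⟩

lemma IsRightCompleteCotorsionPair.cogenerates (hF : IsTorsionFreeClass F)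
    (h : IsRightCompleteCotorsionPair (inQuot F) (kerExt1InQuot F)) :
    Cogenerates (rightPerp1 F) F := by
  intro X hX
  obtain ⟨Y, Z, i, p, w, hS, hZ, hY⟩ := h.2 ⟨X, quot_of_prop hX⟩
  have w' : i.hom ≫ p.hom = 0 := congr($(w).hom)
  have hS' := (hF.shortExact_ι_iff w w').1 hS
  exact ⟨Y.obj, i.hom, hF.rightPerp1_of_kerExt1InQuot (hF.of_shortExact hS' hX hZ) hY, hS'.mono_f⟩

end Complete

/-! ### Powers of an object and quasi-cotilting torsion pairs -/

section ProdClass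

variable {A : Type u} [Category.{v} A]

lemma prodClass_pi [HasLimits A] (Q : A) (I : Type v) : prodClass Q (∏ᶜ fun _ : I => Q) :=
  ⟨I, _, ⟨productIsProduct _⟩, ⟨.refl _⟩⟩

end ProdClass

section Cotilting

variable {A : Type u} [Category.{v} A] [Abelian A] {F : ObjectProperty A}

lemma IsTorsionFreeClass.of_prodClass (hF : IsTorsionFreeClass F) {Q X : A} (hQ : F Q)
    (hX : prodClass Q X) : F X := by
  obtain ⟨I, c, ⟨hc⟩, ⟨r⟩⟩ := hX
  exact hF.of_mono r.i (hF.of_isLimit_fan c hc fun _ => hQ)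

lemma Ext1Vanishes.of_prodClass {Q X Y : A} (hV : Ext1Vanishes X Q) (hY : prodClass Q Y) :
    Ext1Vanishes X Y := by
  obtain ⟨I, c, ⟨hc⟩, ⟨r⟩⟩ := hY
  exact (Ext1Vanishes.of_isLimit_fan c hc fun _ => hV).of_retract_right r

lemma IsQuasiCotiltingTorsionPair.cogenerates {T : ObjectProperty A}
    (h : IsQuasiCotiltingTorsionPair T F) : Cogenerates (rightPerp1 F) F := by
  obtain ⟨-, Q, h₁, -, h₃⟩ := h
  intro X hX
  rw [h₁] at hX
  obtain ⟨Y, f, hY, hf⟩ := hX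
  refine ⟨Y, f, fun Z hZ => Ext1Vanishes.of_prodClass ?_ hY, hf⟩
  rw [h₃] at hZ
  exact hZ.2

/-- If the inclusion of `X` in the product `P` induces a surjection on morphisms to `Q`, then
`Ext¹(-, Q)` vanishes on the cokernel when it vanishes on `P`. -/
lemma Ext1Vanishes.cokernel {X P Q : A} (m : X ⟶ P) (hP : Ext1Vanishes P Q)
    (h : ∀ a : X ⟶ Q, ∃ b : P ⟶ Q, m ≫ b = a) : Ext1Vanishes (cokernel m) Q := by
  refine ext1Vanishes_of_section fun E i p w hS => ?_
  obtain ⟨t, ht⟩ := hP.lift hS (cokernel.π m)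
  have := hS.mono_f
  obtain ⟨a, ha⟩ := hS.exact.lift' (m ≫ t) (by
    change (m ≫ t) ≫ p = 0
    simp [ht])
  have ha : a ≫ i = m ≫ t := ha
  obtain ⟨b, rfl⟩ := h a
  refine ⟨cokernel.desc m (t - b ≫ i) (by simp [← ha]), ?_⟩
  rw [← cancel_epi (cokernel.π m)]
  simp [ht, w]

lemma IsSemiSpecialPrecovering.exists_isQuasiCotiltingTorsionPair [HasLimits A] [HasColimits A]
    [WellPowered.{v} A] [HasCoseparator A] (h : IsSemiSpecialPrecovering F)
    (hF : IsTorsionFreeClass F) (hc : Cogenerates (rightPerp1 F) F) :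
    ∃ T : ObjectProperty A, IsQuasiCotiltingTorsionPair T F := by
  have hcop := h.isClosedUnderCoproducts hF
  obtain ⟨Q, hQ, hFQ⟩ := exists_eq_of_isLeftCompleteCotorsionPair hF hcop
    (h.isLeftCompleteCotorsionPair hF)
  have hQ' (X : A) (hX : F X) : Ext1Vanishes X Q := by
    rw [hFQ] at hX
    exact hX.2
  obtain ⟨N, j, hj, hN, hfac⟩ := exists_trace hcop (coseparator A)
  obtain ⟨Y, P, y, φ, w, hS, hP, hY, hY'⟩ := h.exists_shortExact hF hN
  obtain ⟨W, m, hm, hW, hW'⟩ := h.exists_mono hF hc hP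
  -- `Q` detects `F` inside `Quot(F)`, and `W` makes `R` cogenerate `F`.
  let R : A := Q ⊞ W
  have hR : F R := hF.biprod hQ hW
  have hR' (X : A) (hX : F X) : Ext1Vanishes X R := (hQ' X hX).biprod_right (hW' X hX)
  let ev (X : A) : X ⟶ ∏ᶜ fun _ : X ⟶ R => R := Pi.lift fun g => g
  have hmono (X : A) (hX : F X) : Mono (ev X) := by
    refine Preadditive.mono_of_cancel_zero _ fun {Z} z hz => ?_
    refine (isCoseparator_coseparator A).def _ _ fun f => ?_
    -- A map from `X` to the cogenerator passes through `N`, lifts to `P` and so becomes a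
    -- coordinate of `ev X` after embedding `P` in `R`.
    obtain ⟨f, rfl⟩ := hfac f (quot_of_prop hX)
    obtain ⟨f, rfl⟩ := (hY' X hX).lift hS f
    have h₁ : z ≫ f ≫ m ≫ (biprod.inr : W ⟶ R) = 0 := by
      simpa [ev] using hz =≫ Pi.π _ (f ≫ m ≫ (biprod.inr : W ⟶ R))
    have h₂ : z ≫ f = 0 := by
      rw [← cancel_mono (m ≫ (biprod.inr : W ⟶ R)), zero_comp, Category.assoc, h₁]
    simp [reassoc_of% h₂]
  have hF₁ : F = cogen R := by
    refine le_antisymm (fun X hX => ⟨_, _, prodClass_pi R _, hmono X hX⟩) ?_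
    rintro X ⟨Z, f, hZ, hf⟩
    exact hF.of_mono f (hF.of_prodClass hR hZ)
  have hcok (X : A) (hX : F X) : F (cokernel (ev X)) := by
    have hFpi := hF.of_prodClass hR (prodClass_pi R (X ⟶ R))
    rw [hFQ]
    refine ⟨quot_of_epi (cokernel.π _) (quot_of_prop hFpi),
      -- The power is indexed by all maps `X ⟶ R`, so every `a : X ⟶ Q` extends along `ev X`.
      (hQ' _ hFpi).cokernel _ fun a => ⟨Pi.π _ (a ≫ biprod.inl) ≫ biprod.fst, ?_⟩⟩
    simp [ev]
  obtain ⟨T, hT⟩ := id hF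
  refine ⟨T, hT, R, hF₁, le_antisymm (fun X hX => ?_) ?_, le_antisymm (fun X hX => ?_) ?_⟩
  · have := hmono X hX
    have := hmono _ (hcok X hX)
    exact ⟨_, _, cokernel.π (ev X) ≫ ev _, ev X, by simp, prodClass_pi R _, prodClass_pi R _,
      ⟨isKernelCompMono (shortExact_cokernel (ev X)).fIsKernel _ rfl⟩⟩
  · rintro X ⟨P₀, P₁, g, i, w, h₀, -, ⟨hl⟩⟩
    have : Mono i := mono_of_isLimit_fork hl
    exact hF.of_mono i (hF.of_prodClass hR h₀)
  · rw [subcogen, ← hF₁]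
    exact ⟨quot_of_prop hX, hR' X hX⟩
  · rw [subcogen, ← hF₁]
    rintro X ⟨hX, hXR⟩
    rw [hFQ]
    exact ⟨hX, hXR.of_retract_right ⟨biprod.inl, biprod.fst, by simp⟩⟩

end Cotilting

end CotiltingPrecover

theorem mainTheorem7 {A : Type u} [Category.{v} A] [Abelian A] [HasLimits A] [HasCoseparator A]
    (hA : CotiltingPrecover.IsExt1Small A) (F : ObjectProperty A)
    (hF : CotiltingPrecover.IsTorsionFreeClass F) :
    (HasColimits A ∧ WellPowered.{v} A) ∧
    List.TFAE [
      CotiltingPrecover.IsClosedUnderCoproducts F ∧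
        ∃ Q : A, F Q ∧ F = CotiltingPrecover.quot F ⊓ CotiltingPrecover.leftPerp1Obj Q,
      CotiltingPrecover.IsSemiSpecialPrecovering F,
      CotiltingPrecover.IsClosedUnderCoproducts F ∧
        CotiltingPrecover.IsLeftCompleteCotorsionPair
          (CotiltingPrecover.inQuot F) (CotiltingPrecover.kerExt1InQuot F)] ∧
    (CotiltingPrecover.IsSemiSpecialPrecovering F →
      List.TFAE [
        ∃ T : ObjectProperty A, CotiltingPrecover.IsQuasiCotiltingTorsionPair T F,
        CotiltingPrecover.IsCompleteCotorsionPair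
          (CotiltingPrecover.inQuot F) (CotiltingPrecover.kerExt1InQuot F),
        CotiltingPrecover.Cogenerates (CotiltingPrecover.rightPerp1 F) F]) := by
  have hW : WellPowered.{v} A := CotiltingPrecover.wellPowered_of_hasCoseparator A
  -- An instance of the special adjoint functor theorem, which needs `hW`.
  have hC : HasColimits A := hasColimits_of_hasLimits_of_hasCoseparator
  refine ⟨⟨hC, hW⟩, ?_, fun h => ?_⟩
  · tfae_have 1 → 2 := fun ⟨hc, Q, hQ, h⟩ =>
      CotiltingPrecover.isSemiSpecialPrecovering_of_eq hA hF hc hQ h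
    tfae_have 2 → 3 := fun h =>
      ⟨h.isClosedUnderCoproducts hF, h.isLeftCompleteCotorsionPair hF⟩
    tfae_have 3 → 1 := fun ⟨hc, h⟩ =>
      ⟨hc, CotiltingPrecover.exists_eq_of_isLeftCompleteCotorsionPair hF hc h⟩
    tfae_finish
  · tfae_have 1 → 3 := fun ⟨_, hT⟩ => hT.cogenerates
    tfae_have 3 → 1 := fun hc => h.exists_isQuasiCotiltingTorsionPair hF hc
    tfae_have 3 → 2 := fun hc => h.isCompleteCotorsionPair hF hc
    tfae_have 2 → 3 := fun hc => hc.2.cogenerates hF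
    tfae_finish
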